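/- Theorem 1.1 (Hopf lemma). Let $n\ge 1$, $C>0$, $0<\alpha<1$ and $r>0$. For a unit vector $v\in\mathbb C^n$ let $\pi_v(w)=w-\mathrm{Re}\langle w,v\rangle\,v$ be the orthogonal projection onto the real hyperplane $\{\mathrm{Re}\langle\cdot,v\rangle=0\}$, and for $p\in\mathbb C^n$ let $$\Gamma(p,v,C,\alpha)=\{z\in\mathbb C^n:\ \mathrm{Re}\langle z-p,v\rangle>0,\ \mathrm{Re}\langle z-p,v\rangle>C|\pi_v(z-p)|^\alpha\}$$ be the $(C,\alpha)$-cusp with vertex $p$ and axis $\{p+tv: t>0\}$. Let $\Omega\subset\mathbb C^n$ be a bounded domain (nonempty, open, connected), and let $\delta_\Omega(z)$ denote the Euclidean distance from $z$ to $\partial\Omega$. Suppose that $\Omega$ satisfies the $(C,\alpha,r)$-cusp condition: there is $\varepsilon>0$ such that for every $z\in\Omega$ with $\delta_\Omega(z)<\varepsilon$ there are a point $p\in\partial\Omega$ and a unit vector $v$ such that $z=p+tv$ for some $t>0$, $\Gamma(p,v,C,\alpha)\cap B_r(p)\subset\Omega$, and $|z-p|<r/2$, where $B_r(p)$ is the open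 ball with center $p$ and radius $r$. Then for every plurisubharmonic function $\rho:\Omega\to[-\infty,0)$ there is a constant $c>0$ such that $$\rho(z)\le -c\,\exp\left(-\frac{A}{\delta_\Omega(z)^{1/\alpha-1}}\right)\quad\text{for all } z\in\Omega,\qquad A=\frac{\pi C^{1/\alpha}}{2(1/\alpha-1)}.$$ -/

import Mathlib

open MeasureTheory

noncomputable section

/-- The mean value of an extended-real-valued function `f` over the circle
`{z + e^{iθ} w : 0 < θ ≤ 2π}`, i.e. the mean of the positive part minus the mean of the
negative part. (For an upper semicontinuous `f` with values `< ∞` the first mean is finite, so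
the difference is the usual integral mean, with values in `[-∞, ∞)`.) -/
def circleMean {n : ℕ} (f : EuclideanSpace ℂ (Fin n) → EReal)
    (z w : EuclideanSpace ℂ (Fin n)) : EReal :=
  ((⨍⁻ θ : ℝ in Set.Ioc 0 (2 * Real.pi),
      (f (z + Complex.exp (θ * Complex.I) • w)).toENNReal ∂volume : ENNReal) : EReal)
    - ((⨍⁻ θ : ℝ in Set.Ioc 0 (2 * Real.pi),
      (-f (z + Complex.exp (θ * Complex.I) • w)).toENNReal ∂volume : ENNReal) : EReal)

/-- `f : Ω → [-∞, ∞)` is plurisubharmonic on the open set `Ω`: it is upper semicontinuous and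
satisfies the sub-mean value inequality on every closed affine complex disc contained in `Ω`.
The function `f ≡ -∞` is allowed. -/
structure IsPlurisubharmonicOn {n : ℕ} (f : EuclideanSpace ℂ (Fin n) → EReal)
    (Ω : Set (EuclideanSpace ℂ (Fin n))) : Prop where
  lt_top : ∀ z ∈ Ω, f z < ⊤
  upperSemicontinuousOn : UpperSemicontinuousOn f Ω
  le_circleMean : ∀ z w : EuclideanSpace ℂ (Fin n),
    (∀ ζ : ℂ, ‖ζ‖ ≤ 1 → z + ζ • w ∈ Ω) → f z ≤ circleMean f z w

/-- For a unit vector `v`, the (real) orthogonal projection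
`w ↦ w - Re⟨w, v⟩ v` of `ℂⁿ` onto the real hyperplane `{Re⟨·, v⟩ = 0}`. -/
def hyperplaneProj {n : ℕ} (v w : EuclideanSpace ℂ (Fin n)) : EuclideanSpace ℂ (Fin n) :=
  w - (((inner ℂ v w).re : ℝ) : ℂ) • v

/-- The `(C, α)`-cusp with axis `v` (a unit vector) and vertex `p`. -/
def cusp {n : ℕ} (p v : EuclideanSpace ℂ (Fin n)) (C α : ℝ) :
    Set (EuclideanSpace ℂ (Fin n)) :=
  {z | 0 < (inner ℂ v (z - p)).re ∧
    C * ‖hyperplaneProj v (z - p)‖ ^ α < (inner ℂ v (z - p)).re}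

/-- The distance to the boundary of `Ω`. -/
def boundaryDist {n : ℕ} (Ω : Set (EuclideanSpace ℂ (Fin n)))
    (z : EuclideanSpace ℂ (Fin n)) : ℝ :=
  Metric.infDist z (frontier Ω)

/-- The `(C, α, r)`-cusp condition: every `z ∈ Ω` sufficiently close to the boundary lies on the
axis `{p + t v : t > 0}` of a `(C, α)`-cusp with vertex `p ∈ ∂Ω` whose intersection with
`B_r(p)` is contained in `Ω`, and `|z - p| < r / 2`. -/
def CuspCondition {n : ℕ} (Ω : Set (EuclideanSpace ℂ (Fin n))) (C α r : ℝ) : Prop :=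
  0 < r ∧ ∃ ε : ℝ, 0 < ε ∧ ∀ z ∈ Ω, boundaryDist Ω z < ε →
    ∃ p v : EuclideanSpace ℂ (Fin n), ‖v‖ = 1 ∧
      (∃ t : ℝ, 0 < t ∧ z = p + (t : ℂ) • v) ∧
      p ∈ frontier Ω ∧
      cusp p v C α ∩ Metric.ball p r ⊆ Ω ∧
      ‖z - p‖ < r / 2

/-- The constant `A = π C^{1/α} / (2 (1/α - 1))`. -/
def hopfConst (C α : ℝ) : ℝ :=
  Real.pi * C ^ (1 / α) / (2 * (1 / α - 1))

end

/-! Write β = 1/α - 1 and κ = C^(-1/α). The complex line through the axis cuts the cusp in the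
planar cusp |y| < κ x^(1+β), where ρ is compared with -c h for the harmonic barrier h = Re exp(-A
ζ^(-β) + B ζ^β). Near the vertex the exponent has imaginary part of modulus about A x^(-β) · βκ x^β
= Aβκ on the sides, so A = π/(2βκ) is exactly the value making the phase reach π/2 there. The B-term
pushes it slightly past π/2, so h < 0 on the sides (`exists_cuspExp_re_neg`). Moreover h tends to 0
at the vertex (`eventually_cuspExp_re_le`), and h(t) ≥ exp(-A/t^β) on the axis.

Where h ≥ 0 in the truncated planar cusp, ρ ≤ -c h holds at the boundary: up to an arbitrarily small
error where h is small because ρ < 0, and on the end segment because its relevant points stay a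
fixed distance inside Ω, where ρ is uniformly negative. The maximum principle `le_re_of_le_re`
carries this to the axis, and δ_Ω(z) ≤ t concludes. All constants are fixed before p and v, so c
does not depend on z. -/

/-! ### Maximum principle on complex lines -/

theorem circleMean_le_circleAverage {n : ℕ} {f : EuclideanSpace ℂ (Fin n) → EReal}
    {z w : EuclideanSpace ℂ (Fin n)} {G : ℝ → ℝ} (hG : Continuous G)
    (h : ∀ θ : ℝ, f (z + Complex.exp (θ * Complex.I) • w) ≤ (G θ : EReal)) :
    circleMean f z w ≤ (((2 * Real.pi)⁻¹ * ∫ θ in (0 : ℝ)..2 * Real.pi, G θ : ℝ) : EReal) := by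
  have hpi : (0 : ℝ) < 2 * Real.pi := by positivity
  set μ : Measure ℝ := volume.restrict (Set.Ioc 0 (2 * Real.pi)) with hμ
  have hμu : μ Set.univ = ENNReal.ofReal (2 * Real.pi) := by simp [hμ]
  set ν : Measure ℝ := (μ Set.univ)⁻¹ • μ with hν
  have hint : Integrable G μ := (hG.integrableOn_Icc (a := 0) (b := 2 * Real.pi)).mono_set
    Set.Ioc_subset_Icc_self
  have hνint : Integrable G ν := hint.smul_measure (by simp [hμu, Real.pi_pos])
  have hval : ∫ θ, G θ ∂ν = (2 * Real.pi)⁻¹ * ∫ θ in (0 : ℝ)..2 * Real.pi, G θ := by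
    rw [hν, integral_smul_measure, hμu, intervalIntegral.integral_of_le hpi.le,
      ENNReal.toReal_inv, ENNReal.toReal_ofReal hpi.le, smul_eq_mul]
  have hp : ∫⁻ θ, ENNReal.ofReal (G θ) ∂ν ≠ ⊤ := hνint.lintegral_lt_top.ne
  have hm : ∫⁻ θ, ENNReal.ofReal (-G θ) ∂ν ≠ ⊤ := hνint.neg.lintegral_lt_top.ne
  have e1 : (⨍⁻ θ : ℝ in Set.Ioc 0 (2 * Real.pi),
      (f (z + Complex.exp (θ * Complex.I) • w)).toENNReal ∂volume)
      ≤ ∫⁻ θ, ENNReal.ofReal (G θ) ∂ν := by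
    refine lintegral_mono fun θ => ?_
    simpa using EReal.toENNReal_le_toENNReal (h θ)
  have e2 : ∫⁻ θ, ENNReal.ofReal (-G θ) ∂ν ≤ (⨍⁻ θ : ℝ in Set.Ioc 0 (2 * Real.pi),
      (-f (z + Complex.exp (θ * Complex.I) • w)).toENNReal ∂volume) := by
    refine lintegral_mono fun θ => ?_
    have := EReal.toENNReal_le_toENNReal (EReal.neg_le_neg_iff.2 (h θ))
    rw [← EReal.coe_neg, EReal.toENNReal_of_ne_top (EReal.coe_ne_top _), EReal.toReal_coe] at this
    exact this
  rw [← hval, integral_eq_lintegral_pos_part_sub_lintegral_neg_part hνint, EReal.coe_sub]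
  unfold circleMean
  rw [EReal.coe_ennreal_toReal hp, EReal.coe_ennreal_toReal hm]
  exact EReal.sub_le_sub (by exact_mod_cast e1) (by exact_mod_cast e2)

theorem IsPlurisubharmonicOn.le_re_center {n : ℕ} {ρ : EuclideanSpace ℂ (Fin n) → EReal}
    {Ω : Set (EuclideanSpace ℂ (Fin n))} (hρ : IsPlurisubharmonicOn ρ Ω)
    {p v : EuclideanSpace ℂ (Fin n)} {c : ℂ} {R : ℝ} (hR : 0 < R)
    (hΩ : ∀ ζ ∈ Metric.closedBall c R, p + ζ • v ∈ Ω) {Φ : ℂ → ℂ}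
    (hΦ : DifferentiableOn ℂ Φ (Metric.closedBall c R))
    (h : ∀ ζ ∈ Metric.sphere c R, ρ (p + ζ • v) ≤ ((Φ ζ).re : EReal)) :
    ρ (p + c • v) ≤ ((Φ c).re : EReal) := by
  have hd : DiffContOnCl ℂ Φ (Metric.ball c |R|) := by
    rw [abs_of_pos hR]
    exact ⟨hΦ.mono Metric.ball_subset_closedBall,
      hΦ.continuousOn.mono Metric.closure_ball_subset_closedBall⟩
  have hcm : ∀ θ, circleMap c R θ ∈ Metric.closedBall c R := circleMap_mem_closedBall c hR.le
  have hc : Continuous fun θ => Φ (circleMap c R θ) :=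
    hΦ.continuousOn.comp_continuous (continuous_circleMap c R) hcm
  have key : ∀ θ : ℝ, (p + c • v) + Complex.exp (θ * Complex.I) • ((R : ℂ) • v)
      = p + circleMap c R θ • v := fun θ => by
    simp only [circleMap, add_smul, smul_smul, add_assoc, mul_comm]
  have h1 := hρ.le_circleMean (p + c • v) ((R : ℂ) • v) fun ζ hζ => by
    have := hΩ (c + ζ * R) (by
      simpa [abs_of_pos hR] using mul_le_mul_of_nonneg_right hζ hR.le)
    rwa [add_smul, mul_smul, ← add_assoc] at this
  refine h1.trans ((circleMean_le_circleAverage (G := fun θ => (Φ (circleMap c R θ)).re)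
    (Complex.continuous_re.comp hc) fun θ => ?_).trans_eq ?_)
  · rw [key]
    exact h _ (circleMap_mem_sphere c hR.le θ)
  · have h2 := hd.circleAverage
    rw [Real.circleAverage_def] at h2
    rw [← h2]
    have h3 : ∫ θ in (0 : ℝ)..2 * Real.pi, (Φ (circleMap c R θ)).re
        = (∫ θ in (0 : ℝ)..2 * Real.pi, Φ (circleMap c R θ)).re := by
      have := Complex.reCLM.intervalIntegral_comp_comm
        (hc.intervalIntegrable (μ := volume) 0 (2 * Real.pi))
      simpa using this
    rw [h3]
    simp

/-- Adding δ|ζ|² to ρ - Re Φ makes it strictly subharmonic, so its maximum over K cannot lie in U;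
then δ tends to 0. Any open U ⊆ K will do, so the topological boundary of K never has to be
identified. -/
theorem IsPlurisubharmonicOn.le_re_of_le_re {n : ℕ} {ρ : EuclideanSpace ℂ (Fin n) → EReal}
    {Ω : Set (EuclideanSpace ℂ (Fin n))} (hρ : IsPlurisubharmonicOn ρ Ω)
    {p v : EuclideanSpace ℂ (Fin n)} {K U : Set ℂ} (hK : IsCompact K) (hU : IsOpen U)
    (hUK : U ⊆ K) (hΩ : ∀ ζ ∈ K, p + ζ • v ∈ Ω) {Φ : ℂ → ℂ} (hΦ : DifferentiableOn ℂ Φ K)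
    (h : ∀ ζ ∈ K \ U, ρ (p + ζ • v) ≤ ((Φ ζ).re : EReal)) {ζ : ℂ} (hζ : ζ ∈ K) :
    ρ (p + ζ • v) ≤ ((Φ ζ).re : EReal) := by
  obtain ⟨M, hM⟩ := hK.isBounded.exists_norm_le
  have hM0 : 0 ≤ M := (norm_nonneg _).trans (hM ζ hζ)
  suffices H : ∀ δ : ℝ, 0 < δ → ρ (p + ζ • v) ≤ (((Φ ζ).re + δ * M ^ 2 : ℝ) : EReal) by
    refine EReal.le_of_forall_lt_iff_le.1 fun z hz => ?_
    have hz' : (Φ ζ).re < z := by exact_mod_cast hz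
    refine (H ((z - (Φ ζ).re) / (M ^ 2 + 1)) (by have := sub_pos.2 hz'; positivity)).trans ?_
    norm_cast
    rw [div_mul_eq_mul_div, ← le_sub_iff_add_le', div_le_iff₀ (by positivity)]
    nlinarith
  intro δ hδ
  set k : ℂ → ℝ := fun ζ => δ * ‖ζ‖ ^ 2 - (Φ ζ).re with hk
  have hkc : ContinuousOn k K := by
    have := Complex.continuous_re.comp_continuousOn hΦ.continuousOn
    exact ContinuousOn.sub (by fun_prop) this
  have husc : UpperSemicontinuousOn (fun ζ => ρ (p + ζ • v) + (k ζ : EReal)) K := by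
    refine UpperSemicontinuousOn.add' (hρ.upperSemicontinuousOn.comp
      (g := fun ζ : ℂ => p + ζ • v) (by fun_prop) hΩ) ?_ fun x _ => ?_
    · exact (continuous_coe_real_ereal.comp_continuousOn hkc).upperSemicontinuousOn
    · exact EReal.continuousAt_add (.inr (EReal.coe_ne_bot _)) (.inr (EReal.coe_ne_top _))
  obtain ⟨a, haK, ha⟩ := husc.exists_isMaxOn ⟨ζ, hζ⟩ hK
  have ha' : ∀ ξ ∈ K, ρ (p + ξ • v) + (k ξ : EReal) ≤ ρ (p + a • v) + (k a : EReal) :=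
    fun ξ hξ => ha hξ
  obtain hbot | ⟨m, hm⟩ : ρ (p + a • v) = ⊥ ∨ ∃ m : ℝ, ρ (p + a • v) = m := by
    induction hx : ρ (p + a • v) with
    | bot => exact .inl rfl
    | top => exact absurd hx (hρ.lt_top _ (hΩ a haK)).ne
    | coe x => exact .inr ⟨x, rfl⟩
  · have := ha' ζ hζ
    rw [hbot, EReal.bot_add, le_bot_iff, EReal.add_eq_bot_iff] at this
    rw [this.resolve_right (EReal.coe_ne_bot _)]
    exact bot_le
  have hle : ∀ ξ ∈ K, ρ (p + ξ • v) ≤ ((m + k a - k ξ : ℝ) : EReal) := fun ξ hξ => by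
    have := ha' ξ hξ
    rw [hm] at this
    rw [EReal.coe_sub, EReal.coe_add]
    exact (EReal.le_sub_iff_add_le (.inl (EReal.coe_ne_bot _)) (.inl (EReal.coe_ne_top _))).2 this
  by_cases haU : a ∈ U
  · exfalso
    obtain ⟨R, hR, hRU⟩ := Metric.nhds_basis_closedBall.mem_iff.1 (hU.mem_nhds haU)
    -- On |ξ - a| = R one has |ξ|² = |a|² + R² + 2 Re(ā(ξ - a)), so the upper bound for ρ there is
    -- the real part of a holomorphic function, whose value at a is only m - δR².
    set Ψ : ℂ → ℂ := fun ξ => Φ ξ + ((m + k a - δ * (‖a‖ ^ 2 + R ^ 2) : ℝ) : ℂ)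
      - (2 * δ : ℝ) * ((starRingEnd ℂ) a * (ξ - a)) with hΨ
    have hΨd : DifferentiableOn ℂ Ψ (Metric.closedBall a R) := by
      have := hΦ.mono (hRU.trans hUK)
      rw [hΨ]
      fun_prop
    have := hρ.le_re_center (p := p) (v := v) hR (fun ξ hξ => hΩ ξ (hUK (hRU hξ))) hΨd
      fun ξ hξ => (hle ξ (hUK (hRU (Metric.sphere_subset_closedBall hξ)))).trans_eq (by
        have h1 : ‖ξ - a‖ ^ 2 = R ^ 2 := by rw [mem_sphere_iff_norm.1 hξ]
        rw [← Complex.normSq_eq_norm_sq, Complex.normSq_apply] at h1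
        simp only [hk, hΨ, ← Complex.normSq_eq_norm_sq, Complex.normSq_apply, ← h1]
        congr 1
        simp
        ring)
    rw [hm] at this
    have h2 : m ≤ (Ψ a).re := by exact_mod_cast this
    have h3 : (Ψ a).re = m - δ * R ^ 2 := by
      simp only [hk, hΨ, sub_self, mul_zero, sub_zero, Complex.add_re, Complex.ofReal_re]
      ring
    have : 0 < δ * R ^ 2 := by positivity
    linarith
  · have h1 : m ≤ (Φ a).re := by
      have := h a ⟨haK, haU⟩
      rw [hm] at this
      exact_mod_cast this
    refine (hle ζ hζ).trans ?_
    norm_cast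
    have h2 : ‖a‖ ^ 2 ≤ M ^ 2 := by gcongr; exact hM a haK
    have h3 : 0 ≤ δ * ‖ζ‖ ^ 2 := by positivity
    have h4 := mul_le_mul_of_nonneg_left h2 hδ.le
    simp only [hk]
    linarith

/-! ### The barrier on the planar cusp -/

/-- The holomorphic function `exp (-A ζ^{-β} + B ζ^β)`. -/
noncomputable def cuspExp (A B β : ℝ) (ζ : ℂ) : ℂ :=
  Complex.exp (-(A : ℂ) * ζ ^ ((-β : ℝ) : ℂ) + (B : ℂ) * ζ ^ ((β : ℝ) : ℂ))

theorem differentiableOn_cuspExp (A B β : ℝ) :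
    DifferentiableOn ℂ (cuspExp A B β) {ζ | 0 < ζ.re} := by
  intro ζ hζ
  have h : ζ ∈ Complex.slitPlane := .inl hζ
  unfold cuspExp
  refine DifferentiableAt.differentiableWithinAt ?_
  exact (((differentiableAt_id.cpow_const h).const_mul _).add
    ((differentiableAt_id.cpow_const h).const_mul _)).cexp

theorem cuspExp_re (A B β : ℝ) (ζ : ℂ) :
    (cuspExp A B β ζ).re =
      Real.exp ((-(A * ‖ζ‖ ^ (-β)) + B * ‖ζ‖ ^ β) * Real.cos (β * ζ.arg)) *
        Real.cos ((A * ‖ζ‖ ^ (-β) + B * ‖ζ‖ ^ β) * Real.sin (β * ζ.arg)) := by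
  unfold cuspExp
  rw [Complex.exp_re]
  have e1 : (-(A : ℂ) * ζ ^ ((-β : ℝ) : ℂ) + (B : ℂ) * ζ ^ ((β : ℝ) : ℂ)).re
      = (-(A * ‖ζ‖ ^ (-β)) + B * ‖ζ‖ ^ β) * Real.cos (β * ζ.arg) := by
    rw [← Complex.ofReal_neg, Complex.add_re, Complex.re_ofReal_mul, Complex.re_ofReal_mul,
      Complex.cpow_ofReal_re, Complex.cpow_ofReal_re, mul_neg, Real.cos_neg, mul_comm ζ.arg]
    ring
  have e2 : (-(A : ℂ) * ζ ^ ((-β : ℝ) : ℂ) + (B : ℂ) * ζ ^ ((β : ℝ) : ℂ)).im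
      = (A * ‖ζ‖ ^ (-β) + B * ‖ζ‖ ^ β) * Real.sin (β * ζ.arg) := by
    rw [← Complex.ofReal_neg, Complex.add_im, Complex.im_ofReal_mul, Complex.im_ofReal_mul,
      Complex.cpow_ofReal_im, Complex.cpow_ofReal_im, mul_neg, Real.sin_neg, mul_comm ζ.arg]
    ring
  rw [e1, e2]

theorem cuspExp_re_conj (A B β : ℝ) {ζ : ℂ} (hζ : 0 < ζ.re) :
    (cuspExp A B β ((starRingEnd ℂ) ζ)).re = (cuspExp A B β ζ).re := by
  have : ζ.arg ≠ Real.pi := fun h => by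
    have := (Complex.arg_eq_pi_iff.1 h).1
    linarith
  rw [cuspExp_re, cuspExp_re, Complex.arg_conj, if_neg this, RCLike.norm_conj, mul_neg,
    Real.cos_neg, Real.sin_neg, mul_neg, Real.cos_neg]

theorem exp_neg_le_cuspExp_re {A B β t : ℝ} (hB : 0 ≤ B) (ht : 0 < t) :
    Real.exp (-(A / t ^ β)) ≤ (cuspExp A B β t).re := by
  rw [cuspExp_re, Complex.arg_ofReal_of_nonneg ht.le, Complex.norm_real, Real.norm_of_nonneg ht.le]
  simp only [mul_zero, Real.cos_zero, Real.sin_zero, mul_one]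
  rw [Real.rpow_neg ht.le, div_eq_mul_inv]
  gcongr
  have : 0 ≤ B * t ^ β := by positivity
  linarith

theorem Complex.arg_eq_arctan_of_re_pos {ζ : ℂ} (hζ : 0 < ζ.re) :
    ζ.arg = Real.arctan (ζ.im / ζ.re) := by
  rw [← Complex.tan_arg, Real.arctan_tan]
  · exact (abs_lt.1 (Complex.abs_arg_lt_pi_div_two_iff.2 (.inl hζ))).1
  · exact (abs_lt.1 (Complex.abs_arg_lt_pi_div_two_iff.2 (.inl hζ))).2

theorem Real.abs_arctan_le (x : ℝ) : |Real.arctan x| ≤ |x| := by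
  wlog hx : 0 ≤ x generalizing x
  · simpa using this (-x) (by linarith)
  rw [abs_of_nonneg (Real.arctan_nonneg.2 hx), abs_of_nonneg hx]
  simpa using Real.le_tan (Real.arctan_nonneg.2 hx) (Real.arctan_lt_pi_div_two x)

theorem Real.sub_cube_le_arctan {x : ℝ} (hx : 0 ≤ x) : x * (1 - x ^ 2) ≤ Real.arctan x := by
  refine le_trans ?_ (Real.sin_le (Real.arctan_nonneg.2 hx))
  rw [Real.sin_arctan, div_eq_mul_inv]
  gcongr
  have h1 : √(1 + x ^ 2) ≤ 1 + x ^ 2 := by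
    rw [Real.sqrt_le_left (by positivity)]
    nlinarith [sq_nonneg x]
  have h2 : (1 + x ^ 2)⁻¹ ≤ (√(1 + x ^ 2))⁻¹ := inv_anti₀ (by positivity) h1
  refine le_trans ?_ h2
  rw [← one_div, le_div_iff₀ (by positivity)]
  nlinarith [sq_nonneg (x ^ 2)]

-- The phase of the barrier on the side of slope τ. Its main term is π/2 up to a relative loss of at
-- most (β/2 + d)τ², and the b-term, also of order τ², outweighs that loss. The upper bound keeps
-- the phase where the cosine is negative.
open Filter Topology in
theorem exists_sin_arctan_bounds {β : ℝ} (hβ : 0 < β) : ∃ b : ℝ, 0 ≤ b ∧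
    ∀ᶠ τ in 𝓝[>] (0 : ℝ),
      Real.pi / 2 < (Real.pi / (2 * β * τ) * (1 + τ ^ 2) ^ (-(β / 2)) + b * τ * (1 + τ ^ 2) ^ (β / 2))
        * Real.sin (β * Real.arctan τ) ∧
      (Real.pi / (2 * β * τ) * (1 + τ ^ 2) ^ (-(β / 2)) + b * τ * (1 + τ ^ 2) ^ (β / 2))
        * Real.sin (β * Real.arctan τ) < Real.pi + Real.pi / 2 := by
  -- The 1 comes from arctan τ ≥ τ(1 - τ²), the β²/6 from the cubic term of the sine.
  set d : ℝ := 1 + β ^ 2 / 6 with hd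
  -- Makes the b-term at least 2(β/2 + d)τ², which exceeds the loss (π/2)(β/2 + d)τ² because π < 4.
  set b : ℝ := 4 * (β / 2 + d) / β with hb
  have hbpos : 0 < b := by positivity
  refine ⟨b, hbpos.le, ?_⟩
  have h0 : ∀ᶠ τ in 𝓝[>] (0 : ℝ), 0 < τ := self_mem_nhdsWithin
  have hsmall : ∀ (e : ℝ) (g : ℝ → ℝ), Continuous g → g 0 < e → ∀ᶠ τ in 𝓝[>] (0 : ℝ), g τ < e :=
    fun e g hg h => ((hg.tendsto 0).mono_left nhdsWithin_le_nhds).eventually (gt_mem_nhds h)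
  filter_upwards [h0, hsmall (1 / 2) (fun τ => d * τ ^ 2) (by fun_prop) (by norm_num),
    hsmall (1 / 2) (fun τ => β / 2 * τ ^ 2) (by fun_prop) (by norm_num),
    hsmall (Real.pi / 2) (fun τ => b * β * τ ^ 2) (by fun_prop) (by simp [Real.pi_pos])]
    with τ hτ h1 h2 h3
  have hpi := Real.pi_pos
  set s := Real.sin (β * Real.arctan τ) with hs
  set Q := (1 + τ ^ 2) ^ (-(β / 2)) with hQ
  set P := (1 + τ ^ 2) ^ (β / 2) with hP
  have ha0 : 0 < Real.arctan τ := Real.arctan_pos.2 hτ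
  have haτ : Real.arctan τ ≤ τ := by
    have := Real.abs_arctan_le τ
    rwa [abs_of_pos ha0, abs_of_pos hτ] at this
  have hsle : s ≤ β * τ := (Real.sin_le (by positivity)).trans (by gcongr)
  have hsge : β * τ * (1 - d * τ ^ 2) ≤ s := by
    have e1 := (Real.sin_gt_sub_cube (x := β * Real.arctan τ) (by positivity)).le
    have e2 := Real.sub_cube_le_arctan hτ.le
    have e3 : Real.arctan τ ^ 3 ≤ τ ^ 3 := by gcongr
    have e4 := mul_le_mul_of_nonneg_left e2 hβ.le
    have e5 := mul_le_mul_of_nonneg_left e3 (show 0 ≤ β ^ 3 / 6 by positivity)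
    simp only [hd]
    nlinarith
  have hspos : 0 < s := lt_of_lt_of_le (mul_pos (by positivity) (by linarith)) hsge
  have hP1 : 1 ≤ P := Real.one_le_rpow (by nlinarith [sq_nonneg τ]) (by positivity)
  have hQP : Q = P⁻¹ := Real.rpow_neg (by positivity) _
  have hQ1 : Q ≤ 1 := by rw [hQP]; exact inv_le_one_of_one_le₀ hP1
  have hQge : 1 - β / 2 * τ ^ 2 ≤ Q := by
    have : Real.exp (-(β / 2 * τ ^ 2)) ≤ Q := by
      rw [hQ, Real.rpow_def_of_pos (by positivity)]
      gcongr
      have := Real.log_le_sub_one_of_pos (show 0 < 1 + τ ^ 2 by positivity)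
      nlinarith
    linarith [Real.add_one_le_exp (-(β / 2 * τ ^ 2))]
  have hP2 : P ≤ 2 := by
    have : (2 : ℝ)⁻¹ ≤ P⁻¹ := by rw [← hQP]; linarith
    exact (inv_le_inv₀ (by norm_num) (by linarith)).1 this
  have hsplit : (Real.pi / (2 * β * τ) * Q + b * τ * P) * s
      = Real.pi / 2 * (Q * (s / (β * τ))) + b * τ * P * s := by
    field_simp
  rw [hsplit]
  set σ := s / (β * τ) with hσ
  have hσ1 : σ ≤ 1 := (div_le_one (by positivity)).2 hsle
  have hσge : 1 - d * τ ^ 2 ≤ σ := by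
    rw [hσ, le_div_iff₀ (by positivity)]
    linarith
  have hsσ : s = β * τ * σ := by rw [hσ]; field_simp
  constructor
  · have e1 : (1 - β / 2 * τ ^ 2) * (1 - d * τ ^ 2) ≤ Q * σ :=
      mul_le_mul hQge hσge (by linarith) (by linarith)
    have e2 : b * τ * (β * τ / 2) ≤ b * τ * P * s := by
      rw [mul_assoc (b * τ)]
      gcongr
      rw [hsσ]
      have : 1 / 2 ≤ P * σ := by nlinarith
      nlinarith [mul_pos hβ hτ]
    have e3 : b * τ * (β * τ / 2) = 2 * (β / 2 + d) * τ ^ 2 := by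
      rw [hb]; field_simp; ring
    have e4 : 0 < (β / 2 + d) * τ ^ 2 := by positivity
    have e5 : 0 ≤ (β / 2 * τ ^ 2) * (d * τ ^ 2) := by positivity
    have e6 := Real.pi_lt_four
    have e7 : 1 - (β / 2 + d) * τ ^ 2 ≤ Q * σ := by nlinarith
    nlinarith [mul_le_mul_of_nonneg_left e7 (show 0 ≤ Real.pi / 2 by positivity)]
  · have e1 : Q * σ ≤ 1 := mul_le_one₀ hQ1 (by positivity) hσ1
    have e2 : b * τ * P * s ≤ b * τ * 2 * (β * τ) := by gcongr
    have e3 := mul_le_mul_of_nonneg_left e1 (show 0 ≤ Real.pi / 2 by positivity)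
    have e4 : b * τ * 2 * (β * τ) = 2 * (b * β * τ ^ 2) := by ring
    linarith

open Filter Topology in
/-- Negativity of `Re cuspExp` on the sides of the planar cusp `|y| ≤ κ x^{1+β}`. -/
theorem exists_cuspExp_re_neg {β κ : ℝ} (hβ : 0 < β) (hκ : 0 < κ) : ∃ B : ℝ, 0 ≤ B ∧
    ∀ᶠ x in 𝓝[>] (0 : ℝ), ∀ ζ : ℂ, ζ.re = x → |ζ.im| = κ * x ^ (1 + β) →
      (cuspExp (Real.pi / (2 * β * κ)) B β ζ).re < 0 := by
  obtain ⟨b, hb, hev⟩ := exists_sin_arctan_bounds hβ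
  refine ⟨b * κ, by positivity, ?_⟩
  have h0 : ∀ᶠ x in 𝓝[>] (0 : ℝ), 0 < x := self_mem_nhdsWithin
  have ht : Tendsto (fun x : ℝ => κ * x ^ β) (𝓝[>] 0) (𝓝[>] 0) := by
    refine tendsto_nhdsWithin_iff.2 ⟨?_, ?_⟩
    · have : Tendsto (fun x : ℝ => κ * x ^ β) (𝓝 0) (𝓝 (κ * 0 ^ β)) :=
        ((Real.continuousAt_rpow_const 0 β (.inr hβ.le)).tendsto).const_mul κ
      rw [Real.zero_rpow hβ.ne', mul_zero] at this
      exact this.mono_left nhdsWithin_le_nhds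
    · filter_upwards [h0] with x hx
      exact Set.mem_Ioi.2 (by positivity)
  filter_upwards [h0, ht.eventually hev] with x hx hτ ζ hre him
  wlog him0 : 0 ≤ ζ.im generalizing ζ
  · rw [← cuspExp_re_conj _ _ _ (by rw [hre]; exact hx)]
    exact this _ (by simpa) (by simpa) (by simp; linarith)
  rw [abs_of_nonneg him0] at him
  set τ := κ * x ^ β with hτd
  have hτ0 : 0 < τ := by positivity
  have hxb : 0 < x ^ β := by positivity
  have hq : ζ.im / ζ.re = τ := by
    rw [him, hre, Real.rpow_add hx, Real.rpow_one, hτd]; field_simp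
  have harg : ζ.arg = Real.arctan τ := by
    rw [Complex.arg_eq_arctan_of_re_pos (by rw [hre]; exact hx), hq]
  have hnorm : ‖ζ‖ = x * (1 + τ ^ 2) ^ (1 / 2 : ℝ) := by
    rw [← Real.sqrt_eq_rpow, Complex.norm_eq_sqrt_sq_add_sq, hre,
      show ζ.im = x * τ by rw [← hq, hre]; field_simp,
      show x ^ 2 + (x * τ) ^ 2 = x ^ 2 * (1 + τ ^ 2) by ring, Real.sqrt_mul (by positivity),
      Real.sqrt_sq hx.le]
  have hpow : ∀ c : ℝ, ‖ζ‖ ^ c = x ^ c * (1 + τ ^ 2) ^ (c / 2) := fun c => by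
    rw [hnorm, Real.mul_rpow hx.le (by positivity), ← Real.rpow_mul (by positivity)]
    ring_nf
  -- Since τ = κ x^β, the powers of x are absorbed into τ; this is why B is taken to be bκ.
  have hS : (Real.pi / (2 * β * κ) * ‖ζ‖ ^ (-β) + b * κ * ‖ζ‖ ^ β)
      = Real.pi / (2 * β * τ) * (1 + τ ^ 2) ^ (-(β / 2)) + b * τ * (1 + τ ^ 2) ^ (β / 2) := by
    rw [hpow, hpow, Real.rpow_neg hx.le, neg_div, hτd]
    field_simp
  rw [cuspExp_re, harg, hS]
  refine mul_neg_of_pos_of_neg (Real.exp_pos _) ?_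
  refine Real.cos_neg_of_pi_div_two_lt_of_lt hτ.1 hτ.2

open Filter Topology in
/-- `Re cuspExp` tends to `0` at the vertex of the planar cusp. -/
theorem eventually_cuspExp_re_le {A B β κ : ℝ} (hA : 0 < A) (hβ : 0 < β)
    {ε : ℝ} (hε : 0 < ε) :
    ∀ᶠ x in 𝓝[>] (0 : ℝ), ∀ ζ : ℂ, ζ.re = x → |ζ.im| ≤ κ * x ^ (1 + β) →
      (cuspExp A B β ζ).re ≤ ε := by
  have h0 : ∀ᶠ x in 𝓝[>] (0 : ℝ), 0 < x := self_mem_nhdsWithin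
  have ht : Tendsto (fun N : ℝ => -(A * N ^ (-β)) + B * N ^ β) (𝓝[>] 0) atBot := by
    refine Tendsto.atBot_add (C := B * 0 ^ β) ?_ ?_
    · exact tendsto_neg_atTop_atBot.comp
        ((tendsto_rpow_neg_nhdsGT_zero (neg_lt_zero.2 hβ)).const_mul_atTop hA)
    · exact (((Real.continuousAt_rpow_const 0 β (.inr hβ.le)).tendsto).const_mul B).mono_left
        nhdsWithin_le_nhds
  -- The factor 2 compensates for the bound cos(β arg ζ) ≥ 1/2 below.
  obtain ⟨N₀, hN₀, hN⟩ := mem_nhdsGT_iff_exists_Ioo_subset.1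
    (ht.eventually (eventually_le_atBot (-(2 * |Real.log ε|))))
  have hsmall : ∀ (e : ℝ) (g : ℝ → ℝ), ContinuousAt g 0 → g 0 < e →
      ∀ᶠ τ in 𝓝[>] (0 : ℝ), g τ < e :=
    fun e g hg h => (hg.tendsto.mono_left nhdsWithin_le_nhds).eventually (gt_mem_nhds h)
  have hcont : ContinuousAt (fun x : ℝ => x ^ β) 0 := Real.continuousAt_rpow_const 0 β (.inr hβ.le)
  have hcont' : ContinuousAt (fun x : ℝ => x ^ (1 + β)) 0 :=
    Real.continuousAt_rpow_const 0 _ (.inr (by positivity))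
  filter_upwards [h0, hsmall 1 (fun x => β * (κ * x ^ β)) (by fun_prop)
      (by simp [Real.zero_rpow hβ.ne']),
    hsmall N₀ (fun x => x + κ * x ^ (1 + β)) (by fun_prop)
      (by simpa [Real.zero_rpow (show 1 + β ≠ 0 by positivity)] using hN₀)]
    with x hx h1 h2 ζ hre him
  have hζ0 : 0 < ζ.re := by rwa [hre]
  have hζN : ‖ζ‖ < N₀ := by
    refine (Complex.norm_le_abs_re_add_abs_im ζ).trans_lt (lt_of_le_of_lt ?_ h2)
    rw [hre, abs_of_pos hx]
    linarith
  have hζpos : 0 < ‖ζ‖ := hζ0.trans_le (Complex.re_le_norm ζ)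
  have hE := hN ⟨hζpos, hζN⟩
  simp only [Set.mem_ofPred_eq] at hE
  have harg : |β * ζ.arg| ≤ 1 := by
    rw [abs_mul, abs_of_pos hβ, Complex.arg_eq_arctan_of_re_pos hζ0]
    refine le_trans ?_ h1.le
    gcongr
    refine (Real.abs_arctan_le _).trans ?_
    rw [abs_div, hre, abs_of_pos hx, div_le_iff₀ hx]
    refine him.trans_eq ?_
    rw [Real.rpow_add hx, Real.rpow_one]
    ring
  have hcos : 1 / 2 ≤ Real.cos (β * ζ.arg) := by
    have := Real.one_sub_sq_div_two_le_cos (x := β * ζ.arg)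
    have h3 : (β * ζ.arg) ^ 2 ≤ 1 := by rw [← sq_abs]; exact pow_le_one₀ (abs_nonneg _) harg
    linarith
  rw [cuspExp_re]
  refine (mul_le_of_le_one_right (Real.exp_pos _).le (Real.cos_le_one _)).trans ?_
  rw [← Real.le_log_iff_exp_le hε]
  have h4 := neg_abs_le (Real.log ε)
  nlinarith [abs_nonneg (Real.log ε)]

/-! ### Slices of the cusp and balls inside it -/

theorem norm_hyperplaneProj_le {n : ℕ} {v : EuclideanSpace ℂ (Fin n)} (hv : ‖v‖ = 1)
    (e : EuclideanSpace ℂ (Fin n)) : ‖hyperplaneProj v e‖ ≤ 2 * ‖e‖ := by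
  unfold hyperplaneProj
  refine (norm_sub_le _ _).trans ?_
  rw [norm_smul, hv, mul_one, Complex.norm_real, Real.norm_eq_abs]
  have h1 := Complex.abs_re_le_norm (inner ℂ v e)
  have h2 := norm_inner_le_norm (𝕜 := ℂ) v e
  rw [hv, one_mul] at h2
  linarith

/-- The displacement e changes the axial coordinate by at most s and the projection by at most 2s.
The case s = 0 describes the slice itself; s > 0 gives balls inside the cusp. -/
theorem add_smul_add_mem_cusp {n : ℕ} {p v e : EuclideanSpace ℂ (Fin n)} (hv : ‖v‖ = 1)
    {C α s : ℝ} (hC : 0 < C) (hα : 0 < α) {ζ : ℂ} (he : ‖e‖ ≤ s)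
    (h : C * (|ζ.im| + 2 * s) ^ α < ζ.re - s) : p + ζ • v + e ∈ cusp p v C α := by
  have hs : 0 ≤ s := (norm_nonneg e).trans he
  have hvv : inner ℂ v v = (1 : ℂ) := by
    rw [inner_self_eq_norm_sq_to_K, hv]; simp
  have hw : p + ζ • v + e - p = ζ • v + e := by abel
  have hre : (inner ℂ v (ζ • v + e)).re = ζ.re + (inner ℂ v e).re := by
    rw [inner_add_right, inner_smul_right, hvv, mul_one, Complex.add_re]
  have hve : |(inner ℂ v e).re| ≤ s := by
    have h2 := norm_inner_le_norm (𝕜 := ℂ) v e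
    rw [hv, one_mul] at h2
    exact (Complex.abs_re_le_norm _).trans (h2.trans he)
  have hge : ζ.re - s ≤ (inner ℂ v (p + ζ • v + e - p)).re := by
    rw [hw, hre]
    linarith [neg_abs_le (inner ℂ v e).re]
  have hproj : ‖hyperplaneProj v (p + ζ • v + e - p)‖ ≤ |ζ.im| + 2 * s := by
    have h1 : hyperplaneProj v (ζ • v + e)
        = ((ζ.im : ℂ) * Complex.I) • v + hyperplaneProj v e := by
      unfold hyperplaneProj
      rw [hre]
      nth_rewrite 1 [← Complex.re_add_im ζ]
      push_cast
      module
    rw [hw, h1]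
    refine (norm_add_le _ _).trans (add_le_add ?_ ?_)
    · rw [norm_smul, hv]; simp
    · exact (norm_hyperplaneProj_le hv e).trans (by gcongr)
  have h3 : C * ‖hyperplaneProj v (p + ζ • v + e - p)‖ ^ α ≤ C * (|ζ.im| + 2 * s) ^ α := by
    gcongr
  refine ⟨lt_of_le_of_lt ?_ (h.trans_le hge), h3.trans_lt (h.trans_le hge)⟩
  positivity

theorem ball_subset_cusp_inter_ball {n : ℕ} {p v : EuclideanSpace ℂ (Fin n)} (hv : ‖v‖ = 1)
    {C α r s : ℝ} (hC : 0 < C) (hα : 0 < α) {ζ : ℂ}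
    (h : C * (|ζ.im| + 2 * s) ^ α < ζ.re - s) (hr : ‖ζ‖ + s ≤ r) :
    Metric.ball (p + ζ • v) s ⊆ cusp p v C α ∩ Metric.ball p r := by
  intro w hw
  rw [mem_ball_iff_norm] at hw
  refine ⟨?_, ?_⟩
  · have := add_smul_add_mem_cusp (p := p) hv hC hα hw.le h
    rwa [add_sub_cancel] at this
  · rw [mem_ball_iff_norm]
    have h1 : w - p = ζ • v + (w - (p + ζ • v)) := by abel
    rw [h1]
    refine (norm_add_le _ _).trans_lt ?_
    rw [norm_smul, hv]
    linarith

/-! ### Uniform negativity away from the boundary -/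

theorem IsPlurisubharmonicOn.exists_le_neg {n : ℕ} {ρ : EuclideanSpace ℂ (Fin n) → EReal}
    {Ω K : Set (EuclideanSpace ℂ (Fin n))} (hρ : IsPlurisubharmonicOn ρ Ω)
    (hneg : ∀ z ∈ Ω, ρ z < 0) (hK : IsCompact K) (hKΩ : K ⊆ Ω) :
    ∃ c : ℝ, 0 < c ∧ ∀ z ∈ K, ρ z ≤ ((-c : ℝ) : EReal) := by
  rcases K.eq_empty_or_nonempty with rfl | hne
  · exact ⟨1, one_pos, by simp⟩
  obtain ⟨a, ha, hmax⟩ := (hρ.upperSemicontinuousOn.mono hKΩ).exists_isMaxOn hne hK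
  obtain ⟨x, hx1, hx2⟩ := EReal.lt_iff_exists_real_btwn.1 (hneg a (hKΩ ha))
  refine ⟨-x, by simpa using hx2, fun z hz => ?_⟩
  rw [neg_neg]
  exact (show ρ z ≤ ρ a from hmax hz).trans hx1.le

/-- The points at distance at least s from the complement form a compact subset of Ω. This supplies
one constant for all cusps at once. -/
theorem IsPlurisubharmonicOn.exists_le_neg_of_ball_subset {n : ℕ}
    {ρ : EuclideanSpace ℂ (Fin n) → EReal}
    {Ω : Set (EuclideanSpace ℂ (Fin n))} (hρ : IsPlurisubharmonicOn ρ Ω)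
    (hneg : ∀ z ∈ Ω, ρ z < 0) (hbdd : Bornology.IsBounded Ω) {s : ℝ} (hs : 0 < s) :
    ∃ c : ℝ, 0 < c ∧ ∀ z, Metric.ball z s ⊆ Ω → ρ z ≤ ((-c : ℝ) : EReal) := by
  have hsub : {z | ENNReal.ofReal s ≤ Metric.infEDist z Ωᶜ} ⊆ Ω := fun z hz => by
    by_contra hzΩ
    have h0 : Metric.infEDist z Ωᶜ = 0 := Metric.infEDist_zero_of_mem hzΩ
    rw [Set.mem_ofPred_eq, h0, nonpos_iff_eq_zero, ENNReal.ofReal_eq_zero] at hz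
    linarith
  have hcl : IsClosed {z : EuclideanSpace ℂ (Fin n) | ENNReal.ofReal s ≤ Metric.infEDist z Ωᶜ} :=
    isClosed_le continuous_const Metric.continuous_infEDist
  obtain ⟨c, hc, h⟩ := hρ.exists_le_neg hneg
    (Metric.isCompact_of_isClosed_isBounded hcl (hbdd.subset hsub)) hsub
  refine ⟨c, hc, fun z hz => h z ?_⟩
  refine Metric.le_infEDist.2 fun y hy => ?_
  rw [edist_dist]
  refine ENNReal.ofReal_le_ofReal (not_lt.1 fun hlt => hy (hz ?_))
  rwa [Metric.mem_ball, dist_comm]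

theorem IsPlurisubharmonicOn.exists_le_neg_of_le_boundaryDist {n : ℕ}
    {ρ : EuclideanSpace ℂ (Fin n) → EReal}
    {Ω : Set (EuclideanSpace ℂ (Fin n))} (hρ : IsPlurisubharmonicOn ρ Ω)
    (hneg : ∀ z ∈ Ω, ρ z < 0) (hbdd : Bornology.IsBounded Ω) (hopen : IsOpen Ω) {ε : ℝ}
    (hε : 0 < ε) :
    ∃ c : ℝ, 0 < c ∧ ∀ z ∈ Ω, ε ≤ boundaryDist Ω z → ρ z ≤ ((-c : ℝ) : EReal) := by
  have hcl : IsClosed (closure Ω ∩ {z | ε ≤ boundaryDist Ω z}) :=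
    isClosed_closure.inter (isClosed_le continuous_const (Metric.continuous_infDist_pt _))
  have hsub : closure Ω ∩ {z | ε ≤ boundaryDist Ω z} ⊆ Ω := fun z hz => by
    by_contra hzΩ
    have h0 : boundaryDist Ω z = 0 := Metric.infDist_zero_of_mem (by
      rw [hopen.frontier_eq]; exact ⟨hz.1, hzΩ⟩)
    have := hz.2
    rw [Set.mem_ofPred_eq, h0] at this
    linarith
  obtain ⟨c, hc, h⟩ := hρ.exists_le_neg hneg
    (Metric.isCompact_of_isClosed_isBounded hcl (hbdd.subset hsub)) hsub
  exact ⟨c, hc, fun z hz hd => h z ⟨subset_closure hz, hd⟩⟩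

/-! ### Comparison with the barrier and conclusion -/

/-- Comparison on the slice of a cusp by the complex line through its axis. -/
theorem IsPlurisubharmonicOn.le_neg_cuspExp {n : ℕ} {ρ : EuclideanSpace ℂ (Fin n) → EReal}
    {Ω : Set (EuclideanSpace ℂ (Fin n))} (hρ : IsPlurisubharmonicOn ρ Ω)
    (hneg : ∀ z ∈ Ω, ρ z < 0) {p v : EuclideanSpace ℂ (Fin n)} {A B β κ x₀ c : ℝ}
    (hA : 0 < A) (hB : 0 ≤ B) (hβ : 0 < β) (hκ : 0 < κ) (hc : 0 < c)
    (hside : ∀ ζ : ℂ, 0 < ζ.re → ζ.re ≤ x₀ → |ζ.im| = κ * ζ.re ^ (1 + β) →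
      (cuspExp A B β ζ).re < 0)
    (hΩ : ∀ ζ : ℂ, 0 < ζ.re → ζ.re ≤ x₀ → |ζ.im| < κ * ζ.re ^ (1 + β) → p + ζ • v ∈ Ω)
    (hend : ∀ ζ : ℂ, ζ.re = x₀ → |ζ.im| < κ * x₀ ^ (1 + β) → 0 ≤ (cuspExp A B β ζ).re →
      ρ (p + ζ • v) ≤ ((-(c * (cuspExp A B β ζ).re) : ℝ) : EReal))
    {t : ℝ} (ht0 : 0 < t) (ht : t ≤ x₀) :
    ρ (p + (t : ℂ) • v) ≤ ((-(c * (cuspExp A B β t).re) : ℝ) : EReal) := by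
  suffices H : ∀ ε : ℝ, 0 < ε →
      ρ (p + (t : ℂ) • v) ≤ ((-(c * (cuspExp A B β t).re) + c * ε : ℝ) : EReal) by
    refine EReal.le_of_forall_lt_iff_le.1 fun z hz => ?_
    have hz' : -(c * (cuspExp A B β t).re) < z := by exact_mod_cast hz
    refine (H ((z - -(c * (cuspExp A B β t).re)) / c) (div_pos (sub_pos.2 hz') hc)).trans_eq ?_
    rw [mul_div_cancel₀ _ hc.ne']
    congr 1
    ring
  intro ε hε
  obtain ⟨x₁, hx₁, hx₁0, hx₁t⟩ := ((eventually_cuspExp_re_le (B := B) (κ := κ) hA hβ hε).and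
    (Ioo_mem_nhdsGT ht0)).exists
  have hedge : Continuous fun ζ : ℂ => κ * ζ.re ^ (1 + β) :=
    ((Real.continuous_rpow_const (by positivity)).comp Complex.continuous_re).const_mul κ
  have him : Continuous fun ζ : ℂ => |ζ.im| := Complex.continuous_im.abs
  have hhol := differentiableOn_cuspExp A B β
  have hcont : ContinuousOn (fun ζ => (cuspExp A B β ζ).re) {ζ | 0 < ζ.re} :=
    Complex.continuous_re.comp_continuousOn hhol.continuousOn
  set K₁ : Set ℂ := {ζ | x₁ ≤ ζ.re ∧ ζ.re ≤ x₀ ∧ |ζ.im| ≤ κ * ζ.re ^ (1 + β)} with hK₁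
  -- Restricting to h ≥ 0 removes the sides of the cusp, where h < 0 and the slice may leave Ω.
  set K : Set ℂ := K₁ ∩ (fun ζ => (cuspExp A B β ζ).re) ⁻¹' Set.Ici 0 with hK
  set U₁ : Set ℂ := {ζ | x₁ < ζ.re ∧ ζ.re < x₀ ∧ |ζ.im| < κ * ζ.re ^ (1 + β)} with hU₁
  set U : Set ℂ := U₁ ∩ (fun ζ => (cuspExp A B β ζ).re) ⁻¹' Set.Ioi 0 with hU
  have hK₁pos : K₁ ⊆ {ζ | 0 < ζ.re} := fun ζ hζ => hx₁0.trans_le hζ.1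
  have hU₁K₁ : U₁ ⊆ K₁ := fun ζ hζ => ⟨hζ.1.le, hζ.2.1.le, hζ.2.2.le⟩
  have hK₁cl : IsClosed K₁ := (isClosed_le continuous_const Complex.continuous_re).inter
    ((isClosed_le Complex.continuous_re continuous_const).inter (isClosed_le him hedge))
  have hU₁op : IsOpen U₁ := (isOpen_lt continuous_const Complex.continuous_re).inter
    ((isOpen_lt Complex.continuous_re continuous_const).inter (isOpen_lt him hedge))
  have hKcl : IsClosed K := (hcont.mono hK₁pos).preimage_isClosed_of_isClosed hK₁cl isClosed_Ici
  have hUop : IsOpen U := (hcont.mono (hU₁K₁.trans hK₁pos)).isOpen_inter_preimage hU₁op isOpen_Ioi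
  have hKb : Bornology.IsBounded K := by
    refine (Metric.isBounded_iff_subset_closedBall 0).2 ⟨x₀ + κ * x₀ ^ (1 + β), fun ζ hζ => ?_⟩
    have h0 := hK₁pos hζ.1
    simp only [Set.mem_ofPred_eq] at h0
    rw [mem_closedBall_zero_iff]
    refine (Complex.norm_le_abs_re_add_abs_im ζ).trans (add_le_add ?_ (hζ.1.2.2.trans ?_))
    · rw [abs_of_pos h0]; exact hζ.1.2.1
    · have := hζ.1.2.1
      gcongr
  have hlt : ∀ ζ ∈ K, |ζ.im| < κ * ζ.re ^ (1 + β) := fun ζ hζ =>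
    lt_of_le_of_ne hζ.1.2.2 fun heq =>
      (hside ζ (hK₁pos hζ.1) hζ.1.2.1 heq).not_ge hζ.2
  have hmain := hρ.le_re_of_le_re (p := p) (v := v)
    (Metric.isCompact_of_isClosed_isBounded hKcl hKb) hUop
    (fun ζ hζ => have h : 0 < (cuspExp A B β ζ).re := hζ.2; ⟨hU₁K₁ hζ.1, h.le⟩)
    (fun ζ hζ => hΩ ζ (hK₁pos hζ.1) hζ.1.2.1 (hlt ζ hζ))
    (Φ := fun ζ => (-c : ℝ) * cuspExp A B β ζ + (c * ε : ℝ))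
    (((hhol.mono (Set.inter_subset_left.trans hK₁pos)).const_mul _).add_const _)
    (fun ζ hζ => ?_) (ζ := t) ⟨⟨by simpa using hx₁t.le, by simpa using ht, ?_⟩, ?_⟩
  · refine hmain.trans_eq ?_
    simp [-Complex.ofReal_neg]
  · have hval : (((-c : ℝ) * cuspExp A B β ζ + (c * ε : ℝ) : ℂ)).re
        = -(c * (cuspExp A B β ζ).re) + c * ε := by
      rw [Complex.add_re, Complex.re_ofReal_mul, Complex.ofReal_re]; ring
    rw [hval]
    obtain ⟨hζK, hζU⟩ := hζ
    have hh0 : 0 ≤ (cuspExp A B β ζ).re := hζK.2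
    -- Outside U, either h ≤ ε, which covers the zero set of h and the cut near the vertex, and ρ <
    -- 0 suffices; or ζ lies on the end segment.
    by_cases hsmall : (cuspExp A B β ζ).re ≤ ε
    · refine (hneg _ (hΩ ζ (hK₁pos hζK.1) hζK.1.2.1 (hlt ζ hζK))).le.trans ?_
      have := mul_le_mul_of_nonneg_left hsmall hc.le
      rw [← EReal.coe_zero, EReal.coe_le_coe_iff]
      linarith
    have hx₁ζ : x₁ < ζ.re := lt_of_le_of_ne hζK.1.1 fun heq =>
      hsmall (hx₁ ζ heq.symm (by rw [heq]; exact hζK.1.2.2))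
    have hx₀ζ : ζ.re = x₀ := by
      by_contra hne
      exact hζU ⟨⟨hx₁ζ, lt_of_le_of_ne hζK.1.2.1 hne, hlt ζ hζK⟩,
        Set.mem_Ioi.2 (hε.trans (not_le.1 hsmall))⟩
    refine (hend ζ hx₀ζ (by rw [← hx₀ζ]; exact hlt ζ hζK) hh0).trans ?_
    rw [EReal.coe_le_coe_iff]
    have : 0 < c * ε := by positivity
    linarith
  · simp only [Complex.ofReal_im, abs_zero, Complex.ofReal_re]
    positivity
  · exact (Real.exp_pos _).le.trans (exp_neg_le_cuspExp_re hB ht0)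

open Filter Topology in
theorem theorem1p1 (n : ℕ) (hn : 1 ≤ n) (C α r : ℝ) (hC : 0 < C) (hα0 : 0 < α) (hα1 : α < 1)
    (Ω : Set (EuclideanSpace ℂ (Fin n))) (hopen : IsOpen Ω) (hconn : IsConnected Ω)
    (hbdd : Bornology.IsBounded Ω) (hcusp : CuspCondition Ω C α r)
    (ρ : EuclideanSpace ℂ (Fin n) → EReal) (hpsh : IsPlurisubharmonicOn ρ Ω)
    (hneg : ∀ z ∈ Ω, ρ z < 0) :
    ∃ c : ℝ, 0 < c ∧ ∀ z ∈ Ω,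
      ρ z ≤ ((-(c * Real.exp (-(hopfConst C α / boundaryDist Ω z ^ (1 / α - 1)))) : ℝ) :
        EReal) := by
  obtain ⟨hr, ε, hε, hcusp⟩ := hcusp
  set β := 1 / α - 1 with hβd
  have hβ : 0 < β := sub_pos.2 ((one_lt_div hα0).2 hα1)
  set κ := C ^ (-(1 / α)) with hκd
  have hκ : 0 < κ := Real.rpow_pos_of_pos hC _
  set A := hopfConst C α with hAd
  have hAeq : A = Real.pi / (2 * β * κ) := by
    rw [hAd, hopfConst, ← hβd, hκd, Real.rpow_neg hC.le]
    field_simp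
  have hA : 0 < A := by rw [hAeq]; positivity
  have hβα : 1 + β = α⁻¹ := by rw [hβd]; ring
  have hedge : ∀ x : ℝ, 0 < x → C * (κ * x ^ (1 + β)) ^ α = x := fun x hx => by
    rw [Real.mul_rpow hκ.le (by positivity), hβα, Real.rpow_inv_rpow hx.le hα0.ne', hκd,
      ← Real.rpow_mul hC.le, neg_mul, one_div_mul_cancel hα0.ne', Real.rpow_neg_one]
    field_simp
  obtain ⟨B, hB, hside⟩ := exists_cuspExp_re_neg hβ hκ
  rw [← hAeq] at hside
  have hfit : ∀ᶠ x in 𝓝[>] (0 : ℝ), x + κ * x ^ (1 + β) < r := by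
    have hc : Continuous fun x : ℝ => x + κ * x ^ (1 + β) :=
      continuous_id.add ((Real.continuous_rpow_const (by positivity)).const_mul κ)
    refine ((hc.tendsto 0).mono_left nhdsWithin_le_nhds).eventually (gt_mem_nhds ?_)
    simpa [Real.zero_rpow (show 1 + β ≠ 0 by positivity)] using hr
  obtain ⟨u, hu, hu'⟩ := mem_nhdsGT_iff_exists_Ioo_subset.1 (hside.and hfit)
  have hu0 : 0 < u := hu
  obtain ⟨x₀, hx₀, hx₀u⟩ := exists_between hu0
  have hgood : ∀ x, 0 < x → x ≤ x₀ → (∀ ζ : ℂ, ζ.re = x → |ζ.im| = κ * x ^ (1 + β) →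
      (cuspExp A B β ζ).re < 0) ∧ x + κ * x ^ (1 + β) < r :=
    fun x h1 h2 => hu' ⟨h1, h2.trans_lt hx₀u⟩
  have hE₀ : 0 < κ * x₀ ^ (1 + β) := by positivity
  -- on the segment `Re ζ = x₀` the barrier is positive only well inside the cusp
  obtain ⟨y₁, hy₁0, hy₁E, hy₁⟩ : ∃ y₁ : ℝ, 0 ≤ y₁ ∧ y₁ < κ * x₀ ^ (1 + β) ∧
      ∀ ζ : ℂ, ζ.re = x₀ → |ζ.im| < κ * x₀ ^ (1 + β) → 0 ≤ (cuspExp A B β ζ).re →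
        |ζ.im| ≤ y₁ := by
    have hcont : Continuous fun y : ℝ => (cuspExp A B β ⟨x₀, y⟩).re := by
      refine Complex.continuous_re.comp
        ((differentiableOn_cuspExp A B β).continuousOn.comp_continuous ?_ fun y => hx₀)
      exact Continuous.congr (f := fun y : ℝ => (x₀ : ℂ) + y * Complex.I) (by fun_prop)
        fun y => (Complex.mk_eq_add_mul_I x₀ y).symm
    have hlt : (cuspExp A B β ⟨x₀, κ * x₀ ^ (1 + β)⟩).re < 0 :=
      (hgood x₀ hx₀ le_rfl).1 _ rfl (abs_of_pos hE₀)
    obtain ⟨l, hl, hl'⟩ := exists_Ioc_subset_of_mem_nhds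
      ((hcont.tendsto _).eventually (gt_mem_nhds hlt)) ⟨0, hE₀⟩
    refine ⟨max 0 l, le_max_left _ _, max_lt hE₀ hl, fun ζ h1 h2 h3 => ?_⟩
    by_contra! h4
    have h5 := hl' ⟨(le_max_right _ _).trans_lt h4, h2.le⟩
    simp only [Set.mem_ofPred_eq] at h5
    rcases abs_cases ζ.im with ⟨h6, -⟩ | ⟨h6, -⟩
    · rw [h6, ← h1, Complex.eta] at h5
      exact h5.not_ge h3
    · rw [← cuspExp_re_conj A B β (by rw [h1]; exact hx₀)] at h3
      have h7 : (starRingEnd ℂ) ζ = ⟨x₀, |ζ.im|⟩ := Complex.ext (by simp [h1]) (by simp [h6])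
      rw [h7] at h3
      exact h5.not_ge h3
  -- Balls of radius s fit in Ω around the part |Im ζ| ≤ y₁ of the end segment, and around axis
  -- points with x₀ ≤ t < r/2; the last inequality serves the latter.
  obtain ⟨s, hs, hs1, hs2, hs3⟩ : ∃ s : ℝ, 0 < s ∧ C * (y₁ + 2 * s) ^ α < x₀ - s ∧
      x₀ + y₁ + s ≤ r ∧ r / 2 + s ≤ r := by
    have hc : Continuous fun s : ℝ => C * (y₁ + 2 * s) ^ α + s :=
      (((Real.continuous_rpow_const hα0.le).comp (by fun_prop)).const_mul C).add continuous_id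
    have h1 : C * (y₁ + 2 * 0) ^ α + 0 < x₀ := by
      rw [mul_zero, add_zero, add_zero, ← hedge x₀ hx₀]
      gcongr
    have h2 := (hgood x₀ hx₀ le_rfl).2
    have h3 : 0 < r - (x₀ + y₁) := by linarith
    have hev := ((hc.tendsto 0).mono_left (nhdsWithin_le_nhds (s := Set.Ioi 0))).eventually
      (gt_mem_nhds h1)
    obtain ⟨s, ⟨h4, h5⟩, h6⟩ := ((hev.and (Ioo_mem_nhdsGT h3)).and
      (Ioo_mem_nhdsGT (half_pos hr))).exists
    exact ⟨s, h5.1, by linarith, by linarith [h5.2], by linarith [h6.2]⟩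
  obtain ⟨c₀, hc₀, hball⟩ := hpsh.exists_le_neg_of_ball_subset hneg hbdd hs
  obtain ⟨c₁, hc₁, hfar⟩ := hpsh.exists_le_neg_of_le_boundaryDist hneg hbdd hopen hε
  obtain ⟨M, hM1, hM⟩ : ∃ M : ℝ, 1 ≤ M ∧ ∀ ζ : ℂ, ζ.re = x₀ → |ζ.im| ≤ y₁ →
      (cuspExp A B β ζ).re ≤ M := by
    have hcl : IsClosed {ζ : ℂ | ζ.re = x₀ ∧ |ζ.im| ≤ y₁} :=
      (isClosed_eq Complex.continuous_re continuous_const).inter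
        (isClosed_le Complex.continuous_im.abs continuous_const)
    have hb : Bornology.IsBounded {ζ : ℂ | ζ.re = x₀ ∧ |ζ.im| ≤ y₁} := by
      refine (Metric.isBounded_iff_subset_closedBall 0).2 ⟨x₀ + y₁, fun ζ hζ => ?_⟩
      rw [mem_closedBall_zero_iff]
      refine (Complex.norm_le_abs_re_add_abs_im ζ).trans (add_le_add ?_ hζ.2)
      rw [hζ.1, abs_of_pos hx₀]
    obtain ⟨M, hM⟩ := (Metric.isCompact_of_isClosed_isBounded hcl hb).exists_bound_of_continuousOn
      ((differentiableOn_cuspExp A B β).continuousOn.mono fun ζ hζ => by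
        rw [Set.mem_ofPred_eq, hζ.1]; exact hx₀)
    exact ⟨max 1 M, le_max_left _ _, fun ζ h1 h2 =>
      ((Complex.re_le_norm _).trans (hM ζ ⟨h1, h2⟩)).trans (le_max_right _ _)⟩
  have hM0 : 0 < M := one_pos.trans_le hM1
  -- c₁ handles points far from the boundary; c₀ / M gives c h ≤ c₀ on the end segment, and M ≥ 1
  -- gives c ≤ c₀ for axis points with t ≥ x₀.
  set c := min c₁ (c₀ / M) with hcd
  have hc : 0 < c := lt_min hc₁ (div_pos hc₀ hM0)
  have hcM : c * M ≤ c₀ := (le_div_iff₀ hM0).1 (min_le_right _ _)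
  have hcc₀ : c ≤ c₀ := (le_mul_of_one_le_right hc.le hM1).trans hcM
  refine ⟨c, hc, fun z hz => ?_⟩
  have hd0 : 0 ≤ boundaryDist Ω z := Metric.infDist_nonneg
  have hexp1 : Real.exp (-(A / boundaryDist Ω z ^ β)) ≤ 1 :=
    Real.exp_le_one_iff.2 (neg_nonpos.2 (by positivity))
  have hcrude : ∀ c' : ℝ, c ≤ c' → ρ z ≤ ((-c' : ℝ) : EReal) →
      ρ z ≤ ((-(c * Real.exp (-(A / boundaryDist Ω z ^ β))) : ℝ) : EReal) := fun c' h1 h2 => by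
    refine h2.trans (EReal.coe_le_coe_iff.2 (neg_le_neg ?_))
    exact (mul_le_of_le_one_right hc.le hexp1).trans h1
  rcases le_or_gt ε (boundaryDist Ω z) with hfarz | hnear
  · exact hcrude c₁ (min_le_left _ _) (hfar z hz hfarz)
  obtain ⟨p, v, hv, ⟨t, ht, rfl⟩, hp, hsub, hzr⟩ := hcusp z hz hnear
  have hnormt : ‖p + (t : ℂ) • v - p‖ = t := by
    rw [add_sub_cancel_left, norm_smul, hv, mul_one, Complex.norm_real, Real.norm_of_nonneg ht.le]
  rw [hnormt] at hzr
  rcases le_or_gt x₀ t with hxt | htx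
  · refine hcrude c₀ hcc₀ (hball _ ((ball_subset_cusp_inter_ball hv hC hα0 ?_ ?_).trans hsub))
    · rw [Complex.ofReal_im, Complex.ofReal_re, abs_zero]
      have : C * (0 + 2 * s) ^ α ≤ C * (y₁ + 2 * s) ^ α := by gcongr
      linarith
    · rw [Complex.norm_real, Real.norm_of_nonneg ht.le]
      linarith
  have hslice := hpsh.le_neg_cuspExp hneg (p := p) (v := v) (c := c) hA hB hβ hκ hc
    (fun ζ h1 h2 h3 => (hgood _ h1 h2).1 ζ rfl h3)
    (fun ζ h1 h2 h3 => hsub ⟨?_, ?_⟩) (fun ζ h1 h2 h3 => ?_) ht htx.le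
  · refine hslice.trans (EReal.coe_le_coe_iff.2 (neg_le_neg ?_))
    gcongr
    refine le_trans ?_ (exp_neg_le_cuspExp_re hB ht)
    have hdpos : 0 < boundaryDist Ω (p + (t : ℂ) • v) := by
      refine (isClosed_frontier.notMem_iff_infDist_pos ⟨p, hp⟩).1 fun h => ?_
      rw [hopen.frontier_eq] at h
      exact h.2 hz
    have hdt : boundaryDist Ω (p + (t : ℂ) • v) ≤ t := by
      refine (Metric.infDist_le_dist_of_mem hp).trans_eq ?_
      rw [dist_eq_norm, hnormt]
    gcongr
  · have := add_smul_add_mem_cusp (p := p) (e := 0) (s := 0) hv hC hα0 (ζ := ζ) (by simp) (by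
      rw [mul_zero, add_zero, sub_zero]
      conv_rhs => rw [← hedge _ h1]
      gcongr)
    simpa using this
  · rw [mem_ball_iff_norm, add_sub_cancel_left, norm_smul, hv, mul_one]
    refine (Complex.norm_le_abs_re_add_abs_im ζ).trans_lt ?_
    rw [abs_of_pos h1]
    linarith [(hgood _ h1 h2).2]
  · have hy := hy₁ ζ h1 h2 h3
    refine (hball _ ((ball_subset_cusp_inter_ball hv hC hα0 ?_ ?_).trans hsub)).trans ?_
    · rw [h1]
      have : C * (|ζ.im| + 2 * s) ^ α ≤ C * (y₁ + 2 * s) ^ α := by gcongr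
      linarith
    · have := Complex.norm_le_abs_re_add_abs_im ζ
      rw [h1, abs_of_pos hx₀] at this
      linarith
    · refine EReal.coe_le_coe_iff.2 (neg_le_neg (le_trans ?_ hcM))
      have := hM ζ h1 hy
      gcongr
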